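/- Let $\mathcal X\subseteq\mathbb R^n$ be bounded, let $\mathcal H$ be a real Hilbert space, let $\Phi:\mathcal X\to\mathcal H$ be a feature map with kernel $k(x,x')=\langle\Phi(x),\Phi(x')\rangle_{\mathcal H}$ (for instance $\mathcal H$ is the RKHS of $k$ and $\Phi(x)=k(\cdot,x)$), and put $K=\sup_{x\in\mathcal X}k(x,x)$. Suppose that there are $\rho>0$ and a continuous non-decreasing function $f:[0,\infty)\to[0,\infty)$ with $f(0)=0$ such that $$k(x,x)+k(x',x')-2k(x,x')\le f(\|x-x'\|_2^2)\qquad\text{for all }x,x'\in\mathcal X\text{ with }\|x-x'\|_2\le\rho .$$ Then $K<\infty$ if $\mathcal X\neq\emptyset$, and for every probability measure $\mathbb P$ on $\mathcal X\times\{-1,+1\}$, every $m$ and every $c$ there is a measurable real-valued function $\gamma_{m,c}=\gamma^{\mathbb P}_{m,c}$ of the first $m$ training samples $(x_1,y_1),\dots,(x_m,y_m)\in\mathcal X\times\{-1,+1\}$ such that the following holds. 1. For every $c>0$, if the samples $(x_i,y_i)_{i\ge1}$ are i.i.d. with law $\mathbb P$, then $\lim_{m\to\infty}\gamma_{m,c}=0$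 almost surely, and the convergence is uniform in $\mathbb P$: for all $\varepsilon,\delta>0$ there is an $N$, depending neither on $\mathbb P$ nor on the probability space carrying the samples, such that $\Pr\big(\exists m\ge N:\ |\gamma_{m,c}|\ge\varepsilon\big)\le\delta$ for every $\mathbb P$. 2. For every $\mathbb P$, every $m\ge1$, every $c>0$ and every training set, for all $(w,b)\in\mathcal H\times\mathbb R$ simultaneously, the expectations below exist and $$\mathbb E_{(x,y)\sim\mathbb P}\big[\mathbf 1_{y\ne \mathrm{sgn}(\langle w,\Phi(x)\rangle+b)}\big]\le\gamma_{m,c}+c\|w\|_{\mathcal H}+\frac1m\sum_{i=1}^m\max\big[1-y_i(\langle w,\Phi(x_i)\rangle+b),0\big],$$ $$\mathbb E_{(x,y)\sim\mathbb P}\big[\max(1-y(\langle w,\Phi(x)\rangle+b),0)\big]\le\gamma_{m,c}\big(1+K\|w\|_{\mathcal H}+|b|\big)+c\|w\|_{\mathcal H}+\frac1m\sum_{i=1}^m\max\big[1-y_i(\langle w,\Phi(x_i)\rangle+b),0\big].$$ Here $\mathrm{sgn}(0)=0$, so that $\langle w,\Phi(x)\rangle+b=0$ counts as a classification error. -/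

import Mathlib

open MeasureTheory ProbabilityTheory Filter Topology
open scoped NNReal

universe u v

/-- The label set `{-1, +1}`, with the measurable structure inherited from `ℝ`. -/
abbrev Label : Type := ({-1, 1} : Set ℝ)

/-- A labelled sample `(x, y)` with `x ∈ X` and `y ∈ {-1, +1}`. -/
abbrev LabelledPoint {n : ℕ} (X : Set (EuclideanSpace ℝ (Fin n))) : Type := X × Label

/-- `Z 0, Z 1, …` are i.i.d. random samples with common law `P` on the probability space
`(Ω, μ)`. -/
structure IsIIDSample {Ω S : Type*} [MeasurableSpace Ω] [MeasurableSpace S]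
    (μ : Measure Ω) (P : Measure S) (Z : ℕ → Ω → S) : Prop where
  measurable : ∀ i, Measurable (Z i)
  indep : iIndepFun Z μ
  law : ∀ i, μ.map (Z i) = P

noncomputable section

/-- The decision value `⟨w, Φ(x)⟩ + b`. -/
def decisionValue {α H : Type*} [NormedAddCommGroup H] [InnerProductSpace ℝ H]
    (Φ : α → H) (w : H) (b : ℝ) (x : α) : ℝ :=
  inner ℝ w (Φ x) + b

/-- The 0-1 loss `1_{y ≠ sgn(⟨w, Φ(x)⟩ + b)}`. Here `sgn 0 = 0`, so a vanishing decision value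
counts as an error. -/
def zeroOneLoss {α H : Type*} [NormedAddCommGroup H] [InnerProductSpace ℝ H]
    (Φ : α → H) (w : H) (b : ℝ) (z : α × Label) : ℝ :=
  open Classical in if (z.2 : ℝ) ≠ Real.sign (decisionValue Φ w b z.1) then 1 else 0

/-- The hinge loss `max(1 - y(⟨w, Φ(x)⟩ + b), 0)`. -/
def hingeLoss {α H : Type*} [NormedAddCommGroup H] [InnerProductSpace ℝ H]
    (Φ : α → H) (w : H) (b : ℝ) (z : α × Label) : ℝ :=
  max (1 - (z.2 : ℝ) * decisionValue Φ w b z.1) 0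

/-- The empirical hinge loss `(1/m) ∑ᵢ max(1 - yᵢ(⟨w, Φ(xᵢ)⟩ + b), 0)` of a training set of
size `m`. -/
def empiricalHingeLoss {α H : Type*} [NormedAddCommGroup H] [InnerProductSpace ℝ H]
    (Φ : α → H) (w : H) (b : ℝ) {m : ℕ} (T : Fin m → α × Label) : ℝ :=
  1 / (m : ℝ) * ∑ i, hingeLoss Φ w b (T i)

/-- `K = sup_{x} k(x, x)`. -/
def kernelDiagSup {α : Type*} (k : α → α → ℝ) : ℝ :=
  ⨆ x, k x x

end

/-! The modulus `f` makes `Φ` uniformly continuous and `X` is totally bounded, so for each `c` there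
is a simple function `r`, independent of the law, which rounds samples to finitely many points,
keeps labels, and moves `Φ` by at most `c / 2`. Rounding changes a hinge loss by at most `‖w‖ * c /
2`; doing it once under `P` and once in the empirical mean costs `c * ‖w‖`. What remains compares
two laws on finitely many cells, so for all `(w, b)` at once it is at most `fibreDeviation` times a
bound on the loss (`integral_le_fibreDeviation_add`).

Hoeffding's inequality on each cell and a summable union bound over `m` control this deviation at a
rate depending only on the number of cells. This gives uniformity in `P`, and almost sure
convergence follows. -/

noncomputable section

/-! ### Comparison of expectation and empirical mean through finitely many cells. -/

/-- The total deviation between the law `P` and the empirical law of `T` on the fibres of the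
simple function `r`. -/
def fibreDeviation {S : Type*} [MeasurableSpace S] (P : Measure S) (r : SimpleFunc S S) {m : ℕ}
    (T : Fin m → S) : ℝ :=
  ∑ a ∈ r.range, |P.real (r ⁻¹' {a}) - 1 / (m : ℝ) * ∑ i, (r ⁻¹' {a}).indicator 1 (T i)|

end

theorem fibreDeviation_nonneg {S : Type*} [MeasurableSpace S] (P : Measure S) (r : SimpleFunc S S)
    {m : ℕ} (T : Fin m → S) : 0 ≤ fibreDeviation P r T :=
  Finset.sum_nonneg fun _ _ => abs_nonneg _

theorem measurable_fibreDeviation {S : Type*} [MeasurableSpace S] (P : Measure S)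
    (r : SimpleFunc S S) (m : ℕ) : Measurable fun T : Fin m → S => fibreDeviation P r T := by
  unfold fibreDeviation
  refine Finset.measurable_sum _ fun a _ => ?_
  have h : Measurable ((r ⁻¹' {a}).indicator (1 : S → ℝ)) :=
    measurable_one.indicator (r.measurableSet_fiber a)
  refine Measurable.abs (measurable_const.sub (measurable_const.mul ?_))
  exact Finset.measurable_sum _ fun i _ => h.comp (measurable_pi_apply i)

/-- A function that varies by at most `η` along `r` has an expectation that exceeds its empirical
mean by at most its bound times the deviation, plus `2 * η`. -/
theorem integral_le_fibreDeviation_add {S : Type*} [MeasurableSpace S] (P : Measure S)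
    [IsProbabilityMeasure P] (r : SimpleFunc S S) {m : ℕ} (hm : 0 < m) (T : Fin m → S)
    {g : S → ℝ} (hg : Integrable g P) {B η : ℝ} (hg0 : ∀ z, 0 ≤ g z) (hgB : ∀ z, g z ≤ B)
    (hη : ∀ z, |g z - g (r z)| ≤ η) :
    ∫ z, g z ∂P ≤ fibreDeviation P r T * B + 2 * η + 1 / (m : ℝ) * ∑ i, g (T i) := by
  have hm' : (0 : ℝ) < m := by exact_mod_cast hm
  -- Here the first `η` is spent, on rounding under `P`; `h5` spends the second, on rounding the
  -- training points.
  have h1 : ∫ z, g z ∂P ≤ ∫ z, (r.map g) z ∂P + η := by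
    have hi : Integrable (r.map g) P := SimpleFunc.integrable_of_isFiniteMeasure _
    calc ∫ z, g z ∂P ≤ ∫ z, ((r.map g) z + η) ∂P := by
          refine integral_mono hg (hi.add (integrable_const _)) fun z => ?_
          have := (abs_le.1 (hη z)).2
          simp only [SimpleFunc.map_apply]
          linarith
      _ = _ := by rw [integral_add hi (integrable_const _)]; simp
  have h3 : ∀ z, g (r z) = ∑ a ∈ r.range, (r ⁻¹' {a}).indicator 1 z * g a := by
    intro z
    rw [Finset.sum_eq_single (r z)]
    · simp
    · intro a _ ha
      rw [Set.indicator_of_notMem (by simpa using ha.symm), zero_mul]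
    · intro h
      exact absurd (r.mem_range_self z) h
  have h2 : ∫ z, (r.map g) z ∂P = ∑ a ∈ r.range, P.real (r ⁻¹' {a}) * g a := by
    simp_rw [SimpleFunc.map_apply, h3]
    rw [integral_finsetSum]
    · simp_rw [integral_mul_const, integral_indicator_one (r.measurableSet_fiber _)]
    · exact fun a _ => ((integrable_indicator_iff (r.measurableSet_fiber a)).2
        (integrable_const (1 : ℝ)).integrableOn).mul_const _
  have h4 : 1 / (m : ℝ) * ∑ i, g (r (T i))
      = ∑ a ∈ r.range, (1 / (m : ℝ) * ∑ i, (r ⁻¹' {a}).indicator 1 (T i)) * g a := by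
    simp_rw [h3]
    rw [Finset.sum_comm, Finset.mul_sum]
    simp_rw [mul_assoc, Finset.sum_mul]
  have h5 : 1 / (m : ℝ) * ∑ i, g (r (T i)) ≤ 1 / (m : ℝ) * ∑ i, g (T i) + η := by
    have : ∑ i, g (r (T i)) ≤ ∑ i, (g (T i) + η) :=
      Finset.sum_le_sum fun i _ => by linarith [(abs_le.1 (hη (T i))).1]
    rw [Finset.sum_add_distrib, Finset.sum_const, Finset.card_univ, Fintype.card_fin,
      nsmul_eq_mul] at this
    calc _ ≤ 1 / (m : ℝ) * (∑ i, g (T i) + m * η) := by gcongr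
      _ = _ := by field_simp
  have h6 : ∑ a ∈ r.range, P.real (r ⁻¹' {a}) * g a
      - ∑ a ∈ r.range, (1 / (m : ℝ) * ∑ i, (r ⁻¹' {a}).indicator 1 (T i)) * g a
      ≤ fibreDeviation P r T * B := by
    rw [← Finset.sum_sub_distrib, fibreDeviation, Finset.sum_mul]
    refine Finset.sum_le_sum fun a _ => ?_
    rw [← sub_mul]
    exact mul_le_mul (le_abs_self _) (hgB a) (hg0 a) (abs_nonneg _)
  rw [← h4] at h6
  linarith

/-! ### Concentration of cell frequencies, uniformly in the law. -/

/-- Hoeffding's inequality for the empirical frequency of an event. -/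
theorem IsIIDSample.measure_le_abs_frequency_sub_le {Ω S : Type*} [MeasurableSpace Ω]
    [MeasurableSpace S] {μ : Measure Ω} [IsProbabilityMeasure μ] {P : Measure S} {Z : ℕ → Ω → S}
    (hZ : IsIIDSample μ P Z) {E : Set S} (hE : MeasurableSet E) {ε : ℝ} (hε : 0 ≤ ε) (m : ℕ) :
    μ {ω | ε ≤ |P.real E - 1 / (m : ℝ) * ∑ i : Fin m, E.indicator 1 (Z i ω)|}
      ≤ ENNReal.ofReal (2 * Real.exp (-2 * ε ^ 2) ^ m) := by
  have hE' : Measurable (E.indicator (1 : S → ℝ)) := measurable_one.indicator hE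
  have hX : ∀ i, Measurable fun ω => E.indicator (1 : S → ℝ) (Z i ω) := fun i =>
    hE'.comp (hZ.measurable i)
  have hmean : ∀ i, ∫ ω, E.indicator (1 : S → ℝ) (Z i ω) ∂μ = P.real E := by
    intro i
    rw [← integral_indicator_one hE, ← hZ.law i,
      integral_map (hZ.measurable i).aemeasurable hE'.aestronglyMeasurable]
  have hsub : ∀ i, HasSubgaussianMGF (fun ω => E.indicator (1 : S → ℝ) (Z i ω) - P.real E)
      ((‖(1 : ℝ) - 0‖₊ / 2) ^ 2) μ := by
    intro i
    have := hasSubgaussianMGF_of_mem_Icc (a := 0) (b := 1) (hX i).aemeasurable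
      (μ := μ) (ae_of_all _ fun ω => ⟨Set.indicator_nonneg (fun _ _ => zero_le_one) _,
        Set.indicator_le_self' (fun _ _ => zero_le_one) _⟩)
    rwa [hmean i] at this
  have hind : iIndepFun (fun i ω => E.indicator (1 : S → ℝ) (Z i ω) - P.real E) μ :=
    hZ.indep.comp (fun _ z => E.indicator (1 : S → ℝ) z - P.real E)
      fun _ => hE'.sub measurable_const
  have hindneg : iIndepFun (fun i => -fun ω => E.indicator (1 : S → ℝ) (Z i ω) - P.real E) μ :=
    hZ.indep.comp (fun _ z => -(E.indicator (1 : S → ℝ) z - P.real E))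
      fun _ => (hE'.sub measurable_const).neg
  -- An indicator takes values in `[0, 1]`, so its variance proxy is `1 / 4`. For `m = 0` both sides
  -- are `1`, since division by zero gives exponent `0`.
  have hexp : Real.exp (-(m * ε) ^ 2 / (2 * m * (((‖(1 : ℝ) - 0‖₊ / 2) ^ 2 : ℝ≥0) : ℝ)))
      = Real.exp (-2 * ε ^ 2) ^ m := by
    rw [← Real.exp_nat_mul]
    congr 1
    rcases eq_or_ne (m : ℝ) 0 with h | h
    · simp [h]
    · simp
      field_simp
  have hmε : 0 ≤ m * ε := by positivity
  have hup := HasSubgaussianMGF.measure_sum_range_ge_le_of_iIndepFun hind (n := m) (fun i _ => hsub i) hmε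
  have hlow := HasSubgaussianMGF.measure_sum_range_ge_le_of_iIndepFun hindneg (n := m) (fun i _ => (hsub i).neg) hmε
  rw [hexp] at hup hlow
  rw [← ofReal_measureReal, two_mul]
  refine ENNReal.ofReal_le_ofReal ((measureReal_mono ?_).trans
    ((measureReal_union_le _ _).trans (add_le_add hup hlow)))
  intro ω hω
  have hs : ∑ i ∈ Finset.range m, (E.indicator (1 : S → ℝ) (Z i ω) - P.real E)
      = ∑ i : Fin m, E.indicator (1 : S → ℝ) (Z i ω) - m * P.real E := by
    rw [Finset.sum_sub_distrib, Finset.sum_range]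
    simp
  have hω' : m * ε ≤ |m * P.real E - ∑ i : Fin m, E.indicator (1 : S → ℝ) (Z i ω)| := by
    rcases Nat.eq_zero_or_pos m with rfl | hm
    · simp
    · have hm' : (0 : ℝ) < m := by exact_mod_cast hm
      calc m * ε ≤ m * |P.real E - 1 / (m : ℝ) * ∑ i : Fin m, E.indicator 1 (Z i ω)| := by
            gcongr; exact hω
        _ = _ := by
          rw [← abs_of_pos hm', ← abs_mul, abs_of_pos hm']
          congr 1
          field_simp
  simp only [Set.mem_union, Set.mem_ofPred_eq, Pi.neg_apply, Finset.sum_neg_distrib, hs]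
  rcases le_abs.1 hω' with h | h
  · right; linarith
  · left; linarith

/-- The empirical law converges to the law on the fibres of a simple function, uniformly in the
law. -/
theorem exists_forall_measure_exists_le_fibreDeviation_le {S : Type*} [MeasurableSpace S]
    (r : SimpleFunc S S) {ε δ : ℝ} (hε : 0 < ε) (hδ : 0 < δ) :
    ∃ N : ℕ, ∀ (P : Measure S) (Ω : Type v) [MeasurableSpace Ω] (μ : Measure Ω)
      [IsProbabilityMeasure μ] (Z : ℕ → Ω → S), IsIIDSample μ P Z →
        μ {ω | ∃ m : ℕ, N ≤ m ∧ ε ≤ fibreDeviation P r (fun i : Fin m => Z i ω)}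
          ≤ ENNReal.ofReal δ := by
  -- The `+ 1` covers an empty range and makes `card * κ` strictly smaller than `ε`: if every cell
  -- deviates by less than `κ`, the total stays below `ε`.
  set κ : ℝ := ε / (r.range.card + 1) with hκ
  have hκ0 : 0 < κ := by positivity
  set q : ℝ := Real.exp (-2 * κ ^ 2)
  have hq0 : 0 < q := Real.exp_pos _
  have hq1 : q < 1 := Real.exp_lt_one_iff.2 (by nlinarith [sq_pos_of_pos hκ0])
  -- `F` involves only `ε` and the number of cells, so the `N` that makes its tail sum less than `δ`
  -- serves every law.
  set F : ℕ → ENNReal := fun m => ENNReal.ofReal (r.range.card * (2 * q ^ m))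
  have hF : ∑' m, F m ≠ ⊤ :=
    (((summable_geometric_of_lt_one hq0.le hq1).mul_left 2).mul_left _).tsum_ofReal_ne_top
  obtain ⟨N, hN⟩ := ((tendsto_order.1 (ENNReal.tendsto_sum_nat_add F hF)).2 _
    (ENNReal.ofReal_pos.2 hδ)).exists
  refine ⟨N, fun P Ω _ μ _ Z hZ => le_trans ?_ hN.le⟩
  have hone : ∀ m : ℕ, μ {ω | ε ≤ fibreDeviation P r (fun i : Fin m => Z i ω)} ≤ F m := by
    intro m
    calc μ {ω | ε ≤ fibreDeviation P r (fun i : Fin m => Z i ω)}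
        ≤ μ (⋃ a ∈ r.range, {ω | κ ≤ |P.real (r ⁻¹' {a})
            - 1 / (m : ℝ) * ∑ i : Fin m, (r ⁻¹' {a}).indicator 1 (Z i ω)|}) := by
          refine measure_mono fun ω hω => ?_
          by_contra hcon
          simp only [Set.mem_iUnion, Set.mem_ofPred_eq, not_exists, not_le] at hcon
          have h1 : fibreDeviation P r (fun i : Fin m => Z i ω) ≤ r.range.card * κ := by
            rw [← nsmul_eq_mul]
            exact Finset.sum_le_card_nsmul _ _ _ fun a ha => (hcon a ha).le
          have h2 : (r.range.card + 1) * κ = ε := by rw [hκ]; field_simp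
          have h3 : ε ≤ fibreDeviation P r (fun i : Fin m => Z i ω) := hω
          linarith
      _ ≤ ∑ a ∈ r.range, μ {ω | κ ≤ |P.real (r ⁻¹' {a})
            - 1 / (m : ℝ) * ∑ i : Fin m, (r ⁻¹' {a}).indicator 1 (Z i ω)|} :=
          measure_biUnion_finset_le _ _
      _ ≤ ∑ _a ∈ r.range, ENNReal.ofReal (2 * q ^ m) := Finset.sum_le_sum fun a _ =>
          hZ.measure_le_abs_frequency_sub_le (r.measurableSet_fiber a) hκ0.le m
      _ = F m := by
          rw [Finset.sum_const, nsmul_eq_mul, ← ENNReal.ofReal_natCast,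
            ← ENNReal.ofReal_mul (Nat.cast_nonneg _)]
  calc μ {ω | ∃ m : ℕ, N ≤ m ∧ ε ≤ fibreDeviation P r (fun i : Fin m => Z i ω)}
      ≤ μ (⋃ k : ℕ, {ω | ε ≤ fibreDeviation P r (fun i : Fin (k + N) => Z i ω)}) := by
        refine measure_mono ?_
        rintro ω ⟨m, hm, h⟩
        obtain ⟨k, rfl⟩ := Nat.exists_eq_add_of_le' hm
        exact Set.mem_iUnion.2 ⟨k, h⟩
    _ ≤ ∑' k, F (k + N) :=
        (measure_iUnion_le _).trans (ENNReal.tsum_le_tsum fun k => hone (k + N))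

/-- Tail bounds for the supremum of `|Y m|` over `m ≥ N` give almost sure convergence to zero. -/
theorem ae_tendsto_zero_of_forall_exists_measure_le {Ω : Type*} [MeasurableSpace Ω]
    {μ : Measure Ω} {Y : ℕ → Ω → ℝ}
    (h : ∀ ε : ℝ, 0 < ε → ∀ δ : ℝ, 0 < δ → ∃ N : ℕ,
      μ {ω | ∃ m : ℕ, N ≤ m ∧ ε ≤ |Y m ω|} ≤ ENNReal.ofReal δ) :
    ∀ᵐ ω ∂μ, Tendsto (fun m => Y m ω) atTop (𝓝 0) := by
  have key : ∀ ε : ℝ, 0 < ε → ∀ᵐ ω ∂μ, ∃ N : ℕ, ∀ m, N ≤ m → |Y m ω| < ε := by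
    intro ε hε
    rw [ae_iff]
    refine le_antisymm (le_of_forall_pos_le_add fun δ hδ => ?_) zero_le
    rw [zero_add]
    rcases eq_or_ne δ ⊤ with rfl | hδt
    · exact le_top
    obtain ⟨N, hN⟩ := h ε hε δ.toReal (ENNReal.toReal_pos hδ.ne' hδt)
    rw [ENNReal.ofReal_toReal hδt] at hN
    refine (measure_mono fun ω hω => ?_).trans hN
    simp only [Set.mem_ofPred_eq, not_exists, not_forall, not_lt] at hω
    obtain ⟨m, hm, hle⟩ := hω N
    exact ⟨m, hm, hle⟩
  have hall : ∀ᵐ ω ∂μ, ∀ j : ℕ, ∃ N : ℕ, ∀ m, N ≤ m → |Y m ω| < 1 / ((j : ℝ) + 1) :=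
    ae_all_iff.2 fun j => key _ (by positivity)
  filter_upwards [hall] with ω hω
  refine Metric.tendsto_atTop.2 fun ε hε => ?_
  obtain ⟨j, hj⟩ := exists_nat_one_div_lt hε
  obtain ⟨N, hN⟩ := hω j
  exact ⟨N, fun m hm => by simpa using (hN m hm).trans hj⟩

/-! ### Uniform continuity of the feature map and finite rounding. -/

/-- A feature map whose kernel metric is controlled by a modulus of continuity is uniformly
continuous. -/
theorem uniformContinuous_of_kernel_modulus {E H : Type*} [NormedAddCommGroup E] {X : Set E}
    [NormedAddCommGroup H] [InnerProductSpace ℝ H] {Φ : X → H} {k : X → X → ℝ}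
    (hk : ∀ x x' : X, k x x' = inner ℝ (Φ x) (Φ x')) {ρ : ℝ} (hρ : 0 < ρ) {f : ℝ≥0 → ℝ≥0}
    (hf_cont : Continuous f) (hf_zero : f 0 = 0)
    (hkf : ∀ x x' : X, ‖(x : E) - x'‖ ≤ ρ →
      k x x + k x' x' - 2 * k x x' ≤ f (‖(x : E) - x'‖₊ ^ 2)) : UniformContinuous Φ := by
  refine Metric.uniformContinuous_iff.2 fun ε hε => ?_
  have ht : Tendsto (fun s : ℝ≥0 => f (s ^ 2)) (𝓝 0) (𝓝 0) := by
    have : Continuous fun s : ℝ≥0 => f (s ^ 2) := by fun_prop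
    simpa [hf_zero] using this.tendsto 0
  obtain ⟨η, hη, hlt⟩ := Metric.tendsto_nhds_nhds.1 ht (ε ^ 2) (by positivity)
  refine ⟨min η ρ, lt_min hη hρ, fun {x x'} hx => ?_⟩
  rw [Subtype.dist_eq, dist_eq_norm] at hx
  have h1 := hkf x x' (hx.le.trans (min_le_right _ _))
  have h2 : dist (f (‖(x : E) - x'‖₊ ^ 2)) 0 < ε ^ 2 := hlt (by
    rw [NNReal.dist_eq]
    simpa using hx.trans_le (min_le_left _ _))
  rw [NNReal.dist_eq] at h2
  simp only [NNReal.coe_zero, sub_zero, NNReal.abs_eq] at h2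
  have h3 : ‖Φ x - Φ x'‖ ^ 2 = k x x + k x' x' - 2 * k x x' := by
    rw [hk, hk, hk, norm_sub_sq_real, real_inner_self_eq_norm_sq, real_inner_self_eq_norm_sq]
    ring
  rw [dist_eq_norm]
  exact lt_of_pow_lt_pow_left₀ 2 hε.le (by linarith)

/-- A totally bounded space with finitely many labels can be rounded to finitely many points. -/
theorem exists_simpleFunc_dist_lt {α β : Type*} [PseudoMetricSpace α] [MeasurableSpace α]
    [OpensMeasurableSpace α] [MeasurableSpace β] [Finite β] [MeasurableSingletonClass β]
    (h : TotallyBounded (Set.univ : Set α)) {η : ℝ} (hη : 0 < η) :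
    ∃ r : SimpleFunc (α × β) (α × β), ∀ z, dist z.1 (r z).1 < η ∧ (r z).2 = z.2 := by
  rcases isEmpty_or_nonempty α with hα | ⟨⟨x₀⟩⟩
  · exact ⟨SimpleFunc.ofIsEmpty, fun z => hα.elim z.1⟩
  obtain ⟨t, htf, ht⟩ := Metric.totallyBounded_iff.1 h η hη
  -- `SimpleFunc.nearestPt` needs a sequence of points; inserting `x₀` makes the finite net
  -- nonempty, hence the range of one. The bound `N` below ensures that the first terms already
  -- contain all of `t`.
  obtain ⟨e, he⟩ := (htf.insert x₀).countable.exists_eq_range (Set.insert_nonempty _ _)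
  have hj : ∀ a ∈ t, ∃ j, e j = a := fun a ha => he.subset (Set.mem_insert_of_mem _ ha)
  obtain ⟨N, hN⟩ : ∃ N, ∀ a ∈ t, ∃ j ≤ N, e j = a := by
    choose! j hj using hj
    obtain ⟨N, hN⟩ := (htf.image j).bddAbove
    exact ⟨N, fun a ha => ⟨j a, hN (Set.mem_image_of_mem j ha), hj a ha⟩⟩
  refine ⟨((SimpleFunc.nearestPt e N).comp Prod.fst measurable_fst).pair
    ((SimpleFunc.ofFinite (id : β → β)).comp Prod.snd measurable_snd), fun z => ⟨?_, rfl⟩⟩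
  obtain ⟨a, hat, ha⟩ := Set.mem_iUnion₂.1 (ht (Set.mem_univ z.1))
  obtain ⟨j, hj, rfl⟩ := hN a hat
  have := SimpleFunc.edist_nearestPt_le e z.1 hj
  rw [edist_dist, edist_dist, ENNReal.ofReal_le_ofReal_iff dist_nonneg] at this
  rw [dist_comm]
  refine this.trans_lt ?_
  rw [dist_comm]
  exact ha

theorem abs_label (y : Label) : |(y : ℝ)| = 1 := by
  rcases y.2 with h | h
  · rw [h]; simp
  · rw [show (y : ℝ) = 1 from h]; simp

/-! ### Pointwise estimates of the losses. -/

section HingeLoss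

variable {α H : Type*} [NormedAddCommGroup H] [InnerProductSpace ℝ H] (Φ : α → H) (w : H) (b : ℝ)

theorem hingeLoss_nonneg (z : α × Label) : 0 ≤ hingeLoss Φ w b z := le_max_right _ _

/-- With equal labels the offset `b` cancels, and `max · 0` is 1-Lipschitz. -/
theorem abs_hingeLoss_sub_le (z z' : α × Label) (h : z'.2 = z.2) :
    |hingeLoss Φ w b z - hingeLoss Φ w b z'| ≤ ‖w‖ * ‖Φ z.1 - Φ z'.1‖ := by
  refine (abs_max_sub_max_le_abs _ _ _).trans ?_
  have : 1 - (z.2 : ℝ) * decisionValue Φ w b z.1 - (1 - (z'.2 : ℝ) * decisionValue Φ w b z'.1)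
      = -(z.2 : ℝ) * inner ℝ w (Φ z.1 - Φ z'.1) := by
    rw [h, inner_sub_right]
    simp only [decisionValue]
    ring
  rw [this, abs_mul, abs_neg, abs_label, one_mul]
  exact abs_real_inner_le_norm _ _

theorem hingeLoss_le {R : ℝ} (hR : ∀ x, ‖Φ x‖ ≤ R) (z : α × Label) :
    hingeLoss Φ w b z ≤ 1 + R * ‖w‖ + |b| := by
  have hw : |inner ℝ w (Φ z.1)| ≤ R * ‖w‖ := (abs_real_inner_le_norm _ _).trans
    (by rw [mul_comm]; gcongr; exact hR _)
  have h1 : |(z.2 : ℝ) * decisionValue Φ w b z.1| ≤ R * ‖w‖ + |b| := by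
    rw [abs_mul, abs_label, one_mul]
    exact (abs_add_le _ _).trans (by gcongr)
  have h0 := (abs_nonneg _).trans h1
  exact max_le (by linarith [(abs_le.1 h1).1]) (by linarith)

/-- A classification error means that `y` times the decision value is at most `0`, so the hinge loss
is at least `1`. -/
theorem zeroOneLoss_le_min (z : α × Label) : zeroOneLoss Φ w b z ≤ min (hingeLoss Φ w b z) 1 := by
  unfold zeroOneLoss
  split_ifs with h
  · refine le_min (le_max_of_le_left ?_) le_rfl
    by_contra hcon
    refine h ?_
    rcases z.2.2 with hy | hy <;> rw [hy] at hcon ⊢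
    · rw [Real.sign_of_neg (by linarith)]
    · rw [Real.sign_of_pos (by linarith)]
  · exact le_min (hingeLoss_nonneg _ _ _ _) zero_le_one

end HingeLoss

/-! ### Measurability and integrability of the losses. -/

section Integrability

variable {α H : Type*} [TopologicalSpace α] [MeasurableSpace α] [OpensMeasurableSpace α]
  [NormedAddCommGroup H] [InnerProductSpace ℝ H] {Φ : α → H}

theorem measurable_decisionValue (hΦ : Continuous Φ) (w : H) (b : ℝ) :
    Measurable (decisionValue Φ w b) :=
  ((continuous_const.inner hΦ).add continuous_const).measurable

theorem measurable_hingeLoss (hΦ : Continuous Φ) (w : H) (b : ℝ) :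
    Measurable (hingeLoss Φ w b) := by
  have := measurable_decisionValue hΦ w b
  unfold hingeLoss
  fun_prop

theorem measurable_zeroOneLoss (hΦ : Continuous Φ) (w : H) (b : ℝ) :
    Measurable (zeroOneLoss Φ w b) := by
  have hd : Measurable fun z : α × Label => decisionValue Φ w b z.1 :=
    (measurable_decisionValue hΦ w b).comp measurable_fst
  have hs : Measurable Real.sign := by
    unfold Real.sign
    exact Measurable.ite measurableSet_Iio measurable_const
      (Measurable.ite measurableSet_Ioi measurable_const measurable_const)
  refine Measurable.ite (MeasurableSet.compl ?_) measurable_const measurable_const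
  exact measurableSet_eq_fun (measurable_subtype_coe.comp measurable_snd) (hs.comp hd)

theorem integrable_hingeLoss (hΦ : Continuous Φ) {R : ℝ} (hR : ∀ x, ‖Φ x‖ ≤ R)
    (P : Measure (α × Label)) [IsFiniteMeasure P] (w : H) (b : ℝ) :
    Integrable (hingeLoss Φ w b) P :=
  Integrable.of_mem_Icc 0 (1 + R * ‖w‖ + |b|) (measurable_hingeLoss hΦ w b).aemeasurable
    (ae_of_all _ fun z => ⟨hingeLoss_nonneg _ _ _ _, hingeLoss_le _ _ _ hR z⟩)

theorem integrable_zeroOneLoss (hΦ : Continuous Φ) (P : Measure (α × Label)) [IsFiniteMeasure P]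
    (w : H) (b : ℝ) : Integrable (zeroOneLoss Φ w b) P :=
  Integrable.of_mem_Icc 0 1 (measurable_zeroOneLoss hΦ w b).aemeasurable
    (ae_of_all _ fun z => ⟨by unfold zeroOneLoss; split_ifs <;> norm_num,
      (zeroOneLoss_le_min _ _ _ z).trans (min_le_right _ _)⟩)

end Integrability

/-! ### Risk bounds for a fixed rounding. -/

section GeneralizationBound

variable {α H : Type*} [TopologicalSpace α] [MeasurableSpace α] [OpensMeasurableSpace α]
  [NormedAddCommGroup H] [InnerProductSpace ℝ H] {Φ : α → H}

theorem integral_hingeLoss_le (hΦ : Continuous Φ) {R : ℝ} (hR : ∀ x, ‖Φ x‖ ≤ R)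
    (P : Measure (α × Label)) [IsProbabilityMeasure P]
    {r : SimpleFunc (α × Label) (α × Label)} {c : ℝ}
    (hr : ∀ z, ‖Φ z.1 - Φ (r z).1‖ ≤ c / 2 ∧ (r z).2 = z.2)
    {m : ℕ} (hm : 0 < m) (T : Fin m → α × Label) (w : H) (b : ℝ) :
    ∫ z, hingeLoss Φ w b z ∂P
      ≤ fibreDeviation P r T * (1 + R * ‖w‖ + |b|) + c * ‖w‖ + empiricalHingeLoss Φ w b T := by
  refine (integral_le_fibreDeviation_add P r hm T (integrable_hingeLoss hΦ hR P w b)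
    (hingeLoss_nonneg _ _ _) (hingeLoss_le _ _ _ hR) (η := ‖w‖ * (c / 2)) fun z =>
      (abs_hingeLoss_sub_le _ _ _ _ _ (hr z).2).trans (by gcongr; exact (hr z).1)).trans
    (le_of_eq ?_)
  rw [empiricalHingeLoss]
  ring

/-- The 0-1 loss itself is discontinuous, so the comparison is applied to the hinge loss truncated
at `1`. Truncation keeps the Lipschitz estimate and gives the bound `1`, so the deviation term is
free of `w` and `b`. -/
theorem integral_zeroOneLoss_le (hΦ : Continuous Φ)
    (P : Measure (α × Label)) [IsProbabilityMeasure P]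
    {r : SimpleFunc (α × Label) (α × Label)} {c : ℝ}
    (hr : ∀ z, ‖Φ z.1 - Φ (r z).1‖ ≤ c / 2 ∧ (r z).2 = z.2)
    {m : ℕ} (hm : 0 < m) (T : Fin m → α × Label) (w : H) (b : ℝ) :
    ∫ z, zeroOneLoss Φ w b z ∂P
      ≤ fibreDeviation P r T + c * ‖w‖ + empiricalHingeLoss Φ w b T := by
  have h0 : ∀ z, 0 ≤ min (hingeLoss Φ w b z) 1 := fun z =>
    le_min (hingeLoss_nonneg _ _ _ _) zero_le_one
  have hint : Integrable (fun z => min (hingeLoss Φ w b z) 1) P :=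
    Integrable.of_mem_Icc 0 1 ((measurable_hingeLoss hΦ w b).min measurable_const).aemeasurable
      (ae_of_all _ fun z => ⟨h0 z, min_le_right _ _⟩)
  have hle := integral_le_fibreDeviation_add P r hm T hint h0 (fun z => min_le_right _ _)
    (η := ‖w‖ * (c / 2)) fun z => (abs_min_sub_min_le_max _ _ _ _).trans <|
      max_le ((abs_hingeLoss_sub_le _ _ _ _ _ (hr z).2).trans (by gcongr; exact (hr z).1))
        (by
          have := (norm_nonneg _).trans (hr z).1
          simpa using by positivity)
  have hemp : 1 / (m : ℝ) * ∑ i, min (hingeLoss Φ w b (T i)) 1 ≤ empiricalHingeLoss Φ w b T := by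
    unfold empiricalHingeLoss
    gcongr
    exact min_le_left _ _
  have hmono := integral_mono (integrable_zeroOneLoss hΦ P w b) hint (zeroOneLoss_le_min Φ w b)
  linarith

end GeneralizationBound

theorem mainTheorem5 {n : ℕ} (X : Set (EuclideanSpace ℝ (Fin n))) (hX : Bornology.IsBounded X)
    {H : Type u} [NormedAddCommGroup H] [InnerProductSpace ℝ H] [CompleteSpace H]
    (Φ : X → H) (k : X → X → ℝ) (hk : ∀ x x' : X, k x x' = inner ℝ (Φ x) (Φ x'))
    (ρ : ℝ) (hρ : 0 < ρ) (f : ℝ≥0 → ℝ≥0) (hf_cont : Continuous f) (hf_mono : Monotone f)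
    (hf_zero : f 0 = 0)
    (hkf : ∀ x x' : X, ‖(x : EuclideanSpace ℝ (Fin n)) - x'‖ ≤ ρ →
      k x x + k x' x' - 2 * k x x' ≤ f (‖(x : EuclideanSpace ℝ (Fin n)) - x'‖₊ ^ 2)) :
    -- the supremum `K` of `k(x, x)` is finite
    BddAbove (Set.range fun x : X => k x x) ∧
    -- `γ P m c T` is the random variable `γ_{m,c}` under the law `P`, as a function of the
    -- training set `T` of the first `m` samples
    ∃ γ : ProbabilityMeasure (LabelledPoint X) → (m : ℕ) → ℝ → (Fin m → LabelledPoint X) → ℝ,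
      (∀ P m c, Measurable (γ P m c)) ∧
      -- almost sure convergence to zero, for every `c > 0`
      (∀ c : ℝ, 0 < c → ∀ (P : ProbabilityMeasure (LabelledPoint X))
        (Ω : Type v) [MeasurableSpace Ω] (μ : Measure Ω) [IsProbabilityMeasure μ]
        (Z : ℕ → Ω → LabelledPoint X),
        IsIIDSample μ (P : Measure (LabelledPoint X)) Z →
          ∀ᵐ ω ∂μ, Tendsto (fun m : ℕ => γ P m c (fun i : Fin m => Z i ω)) atTop (𝓝 0)) ∧
      -- uniformity in `P` of the almost sure convergence
      (∀ c : ℝ, 0 < c → ∀ ε : ℝ, 0 < ε → ∀ δ : ℝ, 0 < δ → ∃ N : ℕ,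
        ∀ (P : ProbabilityMeasure (LabelledPoint X))
        (Ω : Type v) [MeasurableSpace Ω] (μ : Measure Ω) [IsProbabilityMeasure μ]
        (Z : ℕ → Ω → LabelledPoint X),
        IsIIDSample μ (P : Measure (LabelledPoint X)) Z →
          μ {ω | ∃ m : ℕ, N ≤ m ∧ ε ≤ |γ P m c (fun i : Fin m => Z i ω)|}
            ≤ ENNReal.ofReal δ) ∧
      -- the two bounds, for every training set and simultaneously for all `(w, b)`
      (∀ (P : ProbabilityMeasure (LabelledPoint X)) (m : ℕ) (c : ℝ), 0 < m → 0 < c →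
        ∀ (T : Fin m → LabelledPoint X) (w : H) (b : ℝ),
          Integrable (zeroOneLoss Φ w b) (P : Measure (LabelledPoint X)) ∧
          Integrable (hingeLoss Φ w b) (P : Measure (LabelledPoint X)) ∧
          ∫ z, zeroOneLoss Φ w b z ∂(P : Measure (LabelledPoint X))
            ≤ γ P m c T + c * ‖w‖ + empiricalHingeLoss Φ w b T ∧
          ∫ z, hingeLoss Φ w b z ∂(P : Measure (LabelledPoint X))
            ≤ γ P m c T * (1 + kernelDiagSup k * ‖w‖ + |b|) + c * ‖w‖
              + empiricalHingeLoss Φ w b T) := by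
  have hΦ := uniformContinuous_of_kernel_modulus hk hρ hf_cont hf_zero hkf
  have hXtb : TotallyBounded (Set.univ : Set X) := by
    have h := totallyBounded_preimage (f := ((↑) : X → EuclideanSpace ℝ (Fin n)))
      isUniformEmbedding_subtype_val.isUniformInducing (hX.isCompact_closure.totallyBounded.subset subset_closure)
    rwa [Subtype.coe_preimage_self] at h
  have hkk : ∀ x, k x x = ‖Φ x‖ ^ 2 := fun x => by rw [hk, real_inner_self_eq_norm_sq]
  have hbdd : BddAbove (Set.range fun x : X => k x x) := by
    obtain ⟨R, hR⟩ := isBounded_iff_forall_norm_le.1 (hXtb.image hΦ).isBounded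
    refine ⟨R ^ 2, ?_⟩
    rintro _ ⟨x, rfl⟩
    have := hR (Φ x) (Set.mem_image_of_mem Φ (Set.mem_univ x))
    simp only [hkk]
    gcongr
  refine ⟨hbdd, ?_⟩
  set K := kernelDiagSup k
  have hK0 : 0 ≤ K := Real.iSup_nonneg fun x => by rw [hkk]; positivity
  have hR : ∀ x, ‖Φ x‖ ≤ √K := fun x => Real.le_sqrt_of_sq_le (by
    rw [← hkk]; exact le_ciSup hbdd x)
  have hr : ∀ c : ℝ, 0 < c → ∃ r : SimpleFunc (LabelledPoint X) (LabelledPoint X),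
      ∀ z, ‖Φ z.1 - Φ (r z).1‖ ≤ c / 2 ∧ (r z).2 = z.2 := by
    intro c hc
    obtain ⟨η, hη, h⟩ := Metric.uniformContinuous_iff.1 hΦ (c / 2) (half_pos hc)
    obtain ⟨r, hr⟩ := exists_simpleFunc_dist_lt (β := Label) hXtb hη
    exact ⟨r, fun z => ⟨by simpa [dist_eq_norm] using (h (hr z).1).le, (hr z).2⟩⟩
  choose r hr using hr
  -- The natural bound on the features is `√K`, while the claim has `K`, which is smaller when `0 <
  -- K < 1`. The factor `1 + 1 / √K` absorbs the difference, since its product with `K` is `K + √K`;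
  -- at `K = 0` the convention `1 / 0 = 0` keeps this valid.
  have hA : 0 < 1 + 1 / √K := by positivity
  have hAK : √K ≤ (1 + 1 / √K) * K := by
    have : (1 + 1 / √K) * K = K + K / √K := by ring
    rw [this, Real.div_sqrt]
    linarith
  have hunif : ∀ c : ℝ, ∀ hc : 0 < c, ∀ ε : ℝ, 0 < ε → ∀ δ : ℝ, 0 < δ → ∃ N : ℕ,
      ∀ (P : ProbabilityMeasure (LabelledPoint X)) (Ω : Type v) [MeasurableSpace Ω]
      (μ : Measure Ω) [IsProbabilityMeasure μ] (Z : ℕ → Ω → LabelledPoint X),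
      IsIIDSample μ (P : Measure (LabelledPoint X)) Z →
        μ {ω | ∃ m : ℕ, N ≤ m ∧ ε ≤ |(1 + 1 / √K) * fibreDeviation
          (P : Measure (LabelledPoint X)) (r c hc) (fun i : Fin m => Z i ω)|}
            ≤ ENNReal.ofReal δ := by
    intro c hc ε hε δ hδ
    obtain ⟨N, hN⟩ := exists_forall_measure_exists_le_fibreDeviation_le (r c hc)
      (div_pos hε hA) hδ
    refine ⟨N, fun P Ω _ μ _ Z hZ => (measure_mono ?_).trans (hN P Ω μ Z hZ)⟩
    rintro ω ⟨m, hm, h⟩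
    rw [abs_of_nonneg (mul_nonneg hA.le (fibreDeviation_nonneg _ _ _))] at h
    exact ⟨m, hm, (div_le_iff₀' hA).2 h⟩
  -- A rounding exists only for `c > 0`; the value `0` elsewhere merely keeps the function
  -- measurable.
  refine ⟨fun P m c T => if hc : 0 < c then
    (1 + 1 / √K) * fibreDeviation (P : Measure (LabelledPoint X)) (r c hc) T else 0, ?_, ?_, ?_, ?_⟩
  · intro P m c
    by_cases hc : 0 < c
    · simp only [dif_pos hc]
      exact (measurable_fibreDeviation _ _ _).const_mul _
    · simp only [dif_neg hc]
      exact measurable_const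
  · intro c hc P Ω _ μ _ Z hZ
    simp only [dif_pos hc]
    exact ae_tendsto_zero_of_forall_exists_measure_le fun ε hε δ hδ =>
      (hunif c hc ε hε δ hδ).imp fun N hN => hN P Ω μ Z hZ
  · intro c hc
    simpa only [dif_pos hc] using hunif c hc
  · intro P m c hm hc T w b
    simp only [dif_pos hc]
    have hD := fibreDeviation_nonneg (P : Measure (LabelledPoint X)) (r c hc) T
    refine ⟨integrable_zeroOneLoss hΦ.continuous _ w b,
      integrable_hingeLoss hΦ.continuous hR _ w b, ?_, ?_⟩
    · refine (integral_zeroOneLoss_le hΦ.continuous _ (hr c hc) hm T w b).trans ?_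
      gcongr
      exact le_mul_of_one_le_left hD (le_add_of_nonneg_right (by positivity))
    · refine (integral_hingeLoss_le hΦ.continuous hR _ (hr c hc) hm T w b).trans ?_
      have h1 : 1 ≤ 1 + 1 / √K := le_add_of_nonneg_right (by positivity)
      have h2 : 1 + √K * ‖w‖ + |b| ≤ (1 + 1 / √K) * (1 + K * ‖w‖ + |b|) := by
        calc 1 + √K * ‖w‖ + |b|
            ≤ (1 + 1 / √K) * 1 + (1 + 1 / √K) * K * ‖w‖ + (1 + 1 / √K) * |b| := by
              refine add_le_add (add_le_add (by linarith) ?_) ?_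
              · exact mul_le_mul_of_nonneg_right hAK (norm_nonneg w)
              · exact le_mul_of_one_le_left (abs_nonneg b) h1
          _ = _ := by ring
      linarith [mul_le_mul_of_nonneg_left h2 hD]
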